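/- Let $K$ be the field of Puiseux series in $t$ with real exponents and real coefficients in which every nonzero series has a highest exponent (Hahn series with reversed exponent order), ordered so that a series is positive iff its leading coefficient (the one at the highest exponent) is positive; write $\deg$ for the leading exponent and $K^+$ for the set of positive elements. Let $\mathbb{TP}^{d-1}=\mathbb R^d/\mathbb R(1,\dots,1)$ with the quotient topology; applying $\deg$ coordinatewise gives a degree map from $(K^+)^d$ to $\mathbb{TP}^{d-1}$. Let $P=\operatorname{tconv}(v_1,\dots,v_k)\subset\mathbb{TP}^{d-1}$, $k\ge 1$, be a tropical polytope (the set of all tropical, i.e. max-plus, linear combinations of $v_1,\dots,v_k$ with real coefficients) that is full-dimensional, i.e. has nonempty interior. Let $\overline v_1,\dots,\overline v_k\in(K^+)^d$ be any lifts of the $v_i$ (that is, $\deg\overline v_i=v_i$ in $\mathbb{TP}^{d-1}$), and let $\overline P=\operatorname{conv}(\overline v_1,\dots,\overline v_k)\subset K^d$ be the corresponding lift of $P$. In particular, $\overline P$ may be a generic lift. Call a linear halfspace $H^+=\{X\in K^d: f_1X_1+\dots+f_dX_d\ge 0\}$ with $f\neq 0$ and bounding hyperplane $H=\{X\in K^d: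 f_1X_1+\dots+f_dX_d=0\}$ *facet-defining* for $\overline P$ if $\overline P\subseteq H^+$ and $\overline P\cap H$ is nonempty with $(d-1)$-dimensional linear span. (When the lifts are normalized to have first coordinate $1$, these are precisely the halfspaces defining the facets of $\overline P$ inside the slice $X_1=1$; in general they define the facets of the cone generated by $\overline P$.) By the image of $H^+$ under the degree map we mean $\deg\bigl(H^+\cap(K^+)^d\bigr)\subseteq\mathbb{TP}^{d-1}$. Then the image of every facet-defining halfspace of $\overline P$ is a tropical halfspace, i.e. a union of some, but not all (and at least one), of the closed sectors of a tropical hyperplane, whose apex may have infinite coordinates. Moreover, the intersection of the interiors of these tropical halfspaces, taken over all facet-defining halfspaces of $\overline P$, is exactly the interior of $P$. -/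

import Mathlib

/-- The field of Puiseux series with real exponents and real coefficients, in which a nonzero series
has a *highest* exponent: Hahn series whose exponent set is `ℝ` with the reversed order.  The type
tag `Lex` carries Mathlib's order on Hahn series, in which `0 < a` iff the leading coefficient of
`a` (the coefficient at the highest exponent) is positive. -/
def PuiseuxField : Type := Lex (HahnSeries ℝᵒᵈ ℝ)

namespace PuiseuxField

noncomputable instance instField : Field PuiseuxField :=
  inferInstanceAs (Field (HahnSeries ℝᵒᵈ ℝ))

noncomputable instance instLinearOrder : LinearOrder PuiseuxField :=
  inferInstanceAs (LinearOrder (Lex (HahnSeries ℝᵒᵈ ℝ)))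

instance instIsStrictOrderedRing : IsStrictOrderedRing PuiseuxField :=
  inferInstanceAs (IsStrictOrderedRing (Lex (HahnSeries ℝᵒᵈ ℝ)))

/-- The underlying Hahn series. -/
def toHahn (a : PuiseuxField) : HahnSeries ℝᵒᵈ ℝ := ofLex (show Lex (HahnSeries ℝᵒᵈ ℝ) from a)

theorem pos_iff (a : PuiseuxField) : 0 < a ↔ 0 < a.toHahn.leadingCoeff :=
  (HahnSeries.leadingCoeff_pos_iff (x := (show Lex (HahnSeries ℝᵒᵈ ℝ) from a))).symm

end PuiseuxField

namespace Tropical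

/-- The degree of a nonzero Puiseux series: its leading (highest) exponent. -/
noncomputable def puiseuxDeg (a : PuiseuxField) : ℝ := OrderDual.ofDual a.toHahn.order

/-- Tropical projective space `ℝ^d / ℝ(1,…,1)`, with the quotient topology. -/
abbrev ProjSpace (d : ℕ) : Type :=
  (Fin d → ℝ) ⧸ Submodule.span ℝ {(fun _ => 1 : Fin d → ℝ)}

/-- The class of a vector in tropical projective space. -/
def ProjSpace.mk {d : ℕ} (x : Fin d → ℝ) : ProjSpace d := Submodule.Quotient.mk x

/-- The tropical polytope `tconv(v_1, …, v_k)`: all tropical linear combinations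
`c_1 ⊙ v_1 ⊕ ⋯ ⊕ c_k ⊙ v_k`.  The representatives of the point `v i` are exactly the vectors
`c_i ⊙ v_i`, `c_i ∈ ℝ`, so the combinations are the componentwise maxima of representatives. -/
def tconv {d : ℕ} {ι : Type*} [Fintype ι] [Nonempty ι] (v : ι → ProjSpace d) :
    Set (ProjSpace d) :=
  {p | ∃ w : ι → Fin d → ℝ, (∀ i, ProjSpace.mk (w i) = v i) ∧
    p = ProjSpace.mk fun j => Finset.univ.sup' Finset.univ_nonempty fun i => w i j}

/-- The set `(K⁺)^d`: all coordinates have positive leading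
coefficient. -/
def posOrthant (d : ℕ) : Set (Fin d → PuiseuxField) := {X | ∀ j, 0 < X j}

/-- The degree map to tropical projective space (meaningful when all coordinates are nonzero). -/
noncomputable def degMap {d : ℕ} (X : Fin d → PuiseuxField) : ProjSpace d :=
  ProjSpace.mk fun j => puiseuxDeg (X j)

/-- `V` is a family of lifts of the points `v`: all coordinates have positive leading coefficients
and `V i` has degree `v i`. -/
def IsLift {d : ℕ} {ι : Type*} (v : ι → ProjSpace d) (V : ι → Fin d → PuiseuxField) : Prop :=
  ∀ i, V i ∈ posOrthant d ∧ degMap (V i) = v i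

/-- The lifted polytope, the convex hull of the lifted points over the Puiseux series field. -/
def liftedPolytope {d : ℕ} {ι : Type*} (V : ι → Fin d → PuiseuxField) :
    Set (Fin d → PuiseuxField) :=
  convexHull PuiseuxField (Set.range V)

/-- The hyperplane `f_1 X_1 + ⋯ + f_d X_d = 0`. -/
def hyperplane {d : ℕ} (f : Fin d → PuiseuxField) : Set (Fin d → PuiseuxField) :=
  {X | ∑ j, f j * X j = 0}

/-- The halfspace `f_1 X_1 + ⋯ + f_d X_d ≥ 0`. -/
def halfspace {d : ℕ} (f : Fin d → PuiseuxField) : Set (Fin d → PuiseuxField) :=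
  {X | 0 ≤ ∑ j, f j * X j}

/-- The halfspace of `f` is facet-defining for `Q`: it contains `Q`, and its bounding hyperplane
meets `Q` in a facet, that is, a nonempty face whose linear span has dimension `d - 1`.  If `Q` lies
in the slice `X_1 = 1`, this says that the face has affine dimension `d - 2`; in general it says
that the face spans a facet of the cone generated by `Q`. -/
def IsFacetDefining {d : ℕ} (Q : Set (Fin d → PuiseuxField)) (f : Fin d → PuiseuxField) : Prop :=
  f ≠ 0 ∧ Q ⊆ halfspace f ∧ (Q ∩ hyperplane f).Nonempty ∧
    Module.finrank PuiseuxField (Submodule.span PuiseuxField (Q ∩ hyperplane f)) + 1 = d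

/-- The image of a halfspace under the degree map: the set of degrees of its points with positive
coordinates. -/
def halfspaceImage {d : ℕ} (f : Fin d → PuiseuxField) : Set (ProjSpace d) :=
  degMap '' (halfspace f ∩ posOrthant d)

/-- The `i`-th closed sector of the tropical hyperplane whose apex has the finite coordinates `a j`,
`j ∈ F`, and infinite coordinates outside `F`: the points where `x_j - a_j` is maximal at `i`. -/
def closedSector {d : ℕ} (F : Finset (Fin d)) (a : Fin d → ℝ) (i : Fin d) : Set (ProjSpace d) :=
  {p | ∃ x : Fin d → ℝ, ProjSpace.mk x = p ∧ ∀ j ∈ F, x j - a j ≤ x i - a i}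

/-- A tropical halfspace: a union of some, but not all, of the closed sectors of a tropical
hyperplane.  Its apex may have infinite coordinates. -/
def IsTropicalHalfspace {d : ℕ} (S : Set (ProjSpace d)) : Prop :=
  ∃ (F A : Finset (Fin d)) (a : Fin d → ℝ), A.Nonempty ∧ A ⊂ F ∧
    S = ⋃ i ∈ A, closedSector F a i

end Tropical

/-! Positive series do not cancel, so `deg` turns sums into maxima. Hence the image of the halfspace
of `f` consists of the `x` for which the maximum of `deg f_j + x_j`, over nonzero `f_j`, is attained
at some positive `f_i` (`mk_mem_halfspaceImage_iff`). This is a tropical halfspace once `f` has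
coefficients of both signs, which holds for a facet because `f` vanishes at a positive vector.

The polytope P is the image of the open cone over the lifts (`mem_tconv_iff`), so P lies in every
such image, and passing to interiors gives one inclusion.

Conversely, interiors make signs certain: every positive lift of an interior point of an image
satisfies `f > 0` strictly (`dotProduct_pos_of_degMap_mem_interior`). A lift of a point in all the
interiors therefore violates no facet inequality. By Farkas' lemma and `exists_facet_functional` it
lies in the cone, so its degree lies in P. Up to positive scaling there are only finitely many facet
functionals, so the interiors can be replaced by finitely many open sets, and an open subset of P
lies in its interior. Nothing depends on which lifts are chosen. -/

open scoped Matrix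

/-! ### Cones and their facets over an ordered field -/

section LinearInequalities

variable {K : Type*} [Field K] {d : ℕ}

theorem exists_dotProduct_eq_zero_of_lt_top {W : Submodule K (Fin d → K)} (hW : W < ⊤) :
    ∃ g : Fin d → K, g ≠ 0 ∧ ∀ x ∈ W, g ⬝ᵥ x = 0 := by
  obtain ⟨φ, hφ, hle⟩ := Submodule.exists_le_ker_of_lt_top W hW
  have hrep : ∀ x, (dotProductEquiv K (Fin d)).symm φ ⬝ᵥ x = φ x := fun x => by
    conv_rhs => rw [← (dotProductEquiv K (Fin d)).apply_symm_apply φ]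
    rfl
  refine ⟨(dotProductEquiv K (Fin d)).symm φ, ?_, fun x hx => ?_⟩
  · simpa using hφ
  · rw [hrep]; exact hle hx

/-- The span of the generators on which the functional `f` vanishes. -/
def zeroSpan {ι : Type*} (V : ι → Fin d → K) (f : Fin d → K) : Submodule K (Fin d → K) :=
  Submodule.span K (V '' {i | f ⬝ᵥ V i = 0})

theorem dotProduct_eq_zero_of_mem_zeroSpan {ι : Type*} {V : ι → Fin d → K} {f x : Fin d → K}
    (hx : x ∈ zeroSpan V f) : f ⬝ᵥ x = 0 := by
  have : zeroSpan V f ≤ LinearMap.ker (dotProductEquiv K (Fin d) f) := by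
    refine Submodule.span_le.mpr ?_
    rintro _ ⟨i, hi, rfl⟩
    exact hi
  exact this hx

variable [LinearOrder K] [IsStrictOrderedRing K]

/-- Farkas' lemma over an ordered field. -/
theorem farkas_dotProduct (n : ℕ) (V : Fin n → Fin d → K) (X : Fin d → K)
    (h : ∀ f : Fin d → K, (∀ i, 0 ≤ f ⬝ᵥ V i) → 0 ≤ f ⬝ᵥ X) :
    ∃ u : Fin n → K, (∀ i, 0 ≤ u i) ∧ X = ∑ i, u i • V i := by
  induction n generalizing X with
  | zero =>
    refine ⟨fun _ => 0, fun _ => le_rfl, ?_⟩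
    have h1 := h (-X) (fun i => i.elim0)
    rw [neg_dotProduct] at h1
    have h2 : 0 ≤ X ⬝ᵥ X := Finset.sum_nonneg fun i _ => mul_self_nonneg _
    have h3 : X ⬝ᵥ X = 0 := by linarith
    simpa using dotProduct_self_eq_zero.mp h3
  | succ n ih =>
    by_cases hc : ∀ f : Fin d → K, (∀ i : Fin n, 0 ≤ f ⬝ᵥ V i.succ) → 0 ≤ f ⬝ᵥ X
    · obtain ⟨u, hu, hX⟩ := ih (fun i => V i.succ) X hc
      refine ⟨Fin.cons 0 u, fun i => ?_, ?_⟩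
      · refine Fin.cases ?_ (fun j => ?_) i
        · simp
        · simpa using hu j
      · simpa [Fin.sum_univ_succ] using hX
    -- Here `g` separates `X` from the later generators, which forces `g` to be negative on `V 0`.
    -- Project along `V 0` onto `g = 0` and recurse; `key` gives the adjoint of this projection.
    · push Not at hc
      obtain ⟨g, hg, hgX⟩ := hc
      have hg0 : g ⬝ᵥ V 0 < 0 := by
        by_contra hn
        refine absurd (h g fun i => ?_) (not_le.mpr hgX)
        exact Fin.cases (not_lt.mp hn) hg i
      set c := g ⬝ᵥ V 0 with hcdef
      have key : ∀ f Y : Fin d → K,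
          f ⬝ᵥ (Y - ((g ⬝ᵥ Y) / c) • V 0) = (f - ((f ⬝ᵥ V 0) / c) • g) ⬝ᵥ Y := by
        intro f Y
        simp only [dotProduct_sub, sub_dotProduct, dotProduct_smul, smul_dotProduct, smul_eq_mul]
        ring
      obtain ⟨u, hu, hX⟩ := ih (fun i => V i.succ - ((g ⬝ᵥ V i.succ) / c) • V 0)
        (X - ((g ⬝ᵥ X) / c) • V 0) (by
          intro f hf
          rw [key]
          apply h
          intro i
          refine Fin.cases ?_ (fun j => ?_) i
          · rw [sub_dotProduct, smul_dotProduct, ← hcdef, smul_eq_mul, div_mul_cancel₀ _ hg0.ne,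
              sub_self]
          · rw [← key]; exact hf j)
      -- Undoing the projection collects this coefficient on `V 0`; it is nonnegative by the signs
      -- of `g` and `c`.
      refine ⟨Fin.cons (g ⬝ᵥ X / c - ∑ i, u i * (g ⬝ᵥ V (Fin.succ i) / c)) u, fun i => ?_, ?_⟩
      · refine Fin.cases ?_ (fun j => ?_) i
        · have h1 : 0 ≤ g ⬝ᵥ X / c := div_nonneg_of_nonpos hgX.le hg0.le
          have h2 : ∑ i, u i * (g ⬝ᵥ V (Fin.succ i) / c) ≤ 0 :=
            Finset.sum_nonpos fun i _ => mul_nonpos_of_nonneg_of_nonpos (hu i)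
              (div_nonpos_of_nonneg_of_nonpos (hg i) hg0.le)
          simp only [Fin.cons_zero]
          linarith
        · simpa using hu j
      · rw [sub_eq_iff_eq_add] at hX
        rw [Fin.sum_univ_succ]
        refine hX.trans ?_
        simp only [Fin.cons_zero, Fin.cons_succ, smul_sub, Finset.sum_sub_distrib, sub_smul,
          Finset.sum_smul, smul_smul]
        abel

theorem exists_nonneg_sum_smul_eq {ι : Type*} [Fintype ι] (V : ι → Fin d → K) (X : Fin d → K)
    (h : ∀ f : Fin d → K, (∀ i, 0 ≤ f ⬝ᵥ V i) → 0 ≤ f ⬝ᵥ X) :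
    ∃ u : ι → K, (∀ i, 0 ≤ u i) ∧ X = ∑ i, u i • V i := by
  let e := Fintype.equivFin ι
  obtain ⟨u, hu, hX⟩ := farkas_dotProduct _ (fun i => V (e.symm i)) X
    (fun f hf => h f fun i => by simpa using hf (e i))
  refine ⟨fun i => u (e i), fun i => hu _, ?_⟩
  rw [hX, ← e.sum_comp]
  simp

theorem finrank_lt_of_dotProduct_eq_zero {W : Submodule K (Fin d → K)} {f : Fin d → K}
    (hf : f ≠ 0) (hW : ∀ x ∈ W, f ⬝ᵥ x = 0) : Module.finrank K W < d := by
  have hne : W ≠ ⊤ := by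
    rintro rfl
    exact hf (dotProduct_self_eq_zero.mp (hW f trivial))
  simpa using Submodule.finrank_lt hne

/-- A point outside the cone over a spanning family is cut off by a facet of the cone. -/
theorem exists_facet_functional {ι : Type*} [Fintype ι] {V : ι → Fin d → K}
    (hV : ∀ g : Fin d → K, (∀ i, g ⬝ᵥ V i = 0) → g = 0) {X f₀ : Fin d → K}
    (hf₀ : ∀ i, 0 ≤ f₀ ⬝ᵥ V i) (hX : f₀ ⬝ᵥ X < 0) :
    ∃ f : Fin d → K, (∀ i, 0 ≤ f ⬝ᵥ V i) ∧ f ⬝ᵥ X < 0 ∧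
      Module.finrank K (zeroSpan V f) + 1 = d := by
  let S : Set ℕ := {n | ∃ f : Fin d → K, (∀ i, 0 ≤ f ⬝ᵥ V i) ∧ f ⬝ᵥ X < 0 ∧
    Module.finrank K (zeroSpan V f) = n}
  have hS : S.Nonempty := ⟨_, f₀, hf₀, hX, rfl⟩
  have hlt : ∀ f : Fin d → K, f ⬝ᵥ X < 0 → Module.finrank K (zeroSpan V f) < d := by
    intro f hf
    refine finrank_lt_of_dotProduct_eq_zero ?_ fun x => dotProduct_eq_zero_of_mem_zeroSpan
    rintro rfl
    simp at hf
  have hbdd : BddAbove S := ⟨d, by rintro _ ⟨f, -, hf, rfl⟩; exact (hlt f hf).le⟩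
  -- Among the functionals separating `X`, take one whose zero span has maximal rank. If the rank
  -- were below `d - 1`, the functional could be tilted with its value at `X` fixed until a further
  -- generator is hit.
  obtain ⟨f, hf, hfX, hfr⟩ := Nat.sSup_mem hS hbdd
  refine ⟨f, hf, hfX, ?_⟩
  by_contra hne
  have hsmall : Module.finrank K (zeroSpan V f) + 1 < d := lt_of_le_of_ne (hlt f hfX) hne
  have htop : zeroSpan V f ⊔ Submodule.span K {X} < ⊤ := by
    rw [lt_top_iff_ne_top]
    intro h
    have h1 := Submodule.finrank_add_le_finrank_add_finrank (zeroSpan V f) (Submodule.span K {X})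
    have h2 := finrank_span_le_card (R := K) ({X} : Set (Fin d → K))
    rw [Set.toFinset_singleton, Finset.card_singleton] at h2
    rw [h] at h1
    simp only [finrank_top, Module.finrank_fintype_fun_eq_card, Fintype.card_fin] at h1
    omega
  obtain ⟨g, hg0, hg⟩ := exists_dotProduct_eq_zero_of_lt_top htop
  obtain ⟨g, hg, i₀, hi₀⟩ : ∃ g : Fin d → K,
      (∀ x ∈ zeroSpan V f ⊔ Submodule.span K {X}, g ⬝ᵥ x = 0) ∧ ∃ i, g ⬝ᵥ V i < 0 := by
    have : ∃ i, g ⬝ᵥ V i ≠ 0 := by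
      by_contra! h
      exact hg0 (hV g h)
    obtain ⟨i, hi⟩ := this
    rcases lt_or_gt_of_ne hi with hi | hi
    · exact ⟨g, hg, i, hi⟩
    · exact ⟨-g, fun x hx => by rw [neg_dotProduct, hg x hx, neg_zero], i, by
        rw [neg_dotProduct]; linarith⟩
  have hgX : g ⬝ᵥ X = 0 := hg X (Submodule.mem_sup_right (Submodule.mem_span_singleton_self X))
  have hgW : ∀ x ∈ zeroSpan V f, g ⬝ᵥ x = 0 := fun x hx => hg x (Submodule.mem_sup_left hx)
  obtain ⟨m, hm, hmin⟩ := Finset.exists_min_image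
    (Finset.univ.filter fun i => g ⬝ᵥ V i < 0) (fun i => f ⬝ᵥ V i / -(g ⬝ᵥ V i))
    ⟨i₀, by simpa using hi₀⟩
  simp only [Finset.mem_filter, Finset.mem_univ, true_and] at hm hmin
  -- The minimal ratio is the largest tilt that keeps all generators on the nonnegative side.
  set s := f ⬝ᵥ V m / -(g ⬝ᵥ V m) with hs
  have hs0 : 0 ≤ s := div_nonneg (hf m) (by linarith)
  have hval : ∀ Y, (f + s • g) ⬝ᵥ Y = f ⬝ᵥ Y + s * (g ⬝ᵥ Y) := fun Y => by
    simp [add_dotProduct, smul_dotProduct]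
  have hm0 : (f + s • g) ⬝ᵥ V m = 0 := by
    rw [hval, hs, div_neg, neg_mul, div_mul_cancel₀ _ hm.ne, add_neg_cancel]
  have hnn : ∀ i, 0 ≤ (f + s • g) ⬝ᵥ V i := by
    intro i
    rw [hval]
    rcases lt_or_ge (g ⬝ᵥ V i) 0 with hi | hi
    · have h1 := hmin i hi
      rw [le_div_iff₀ (by linarith)] at h1
      linarith
    · exact add_nonneg (hf i) (mul_nonneg hs0 hi)
  have hltW : zeroSpan V f < zeroSpan V (f + s • g) := by
    refine lt_of_le_of_ne (Submodule.span_mono ?_) ?_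
    · rintro _ ⟨i, hi, rfl⟩
      refine ⟨i, ?_, rfl⟩
      have h1 : g ⬝ᵥ V i = 0 := hgW _ (Submodule.subset_span ⟨i, hi, rfl⟩)
      have h2 : f ⬝ᵥ V i = 0 := hi
      simp [hval, h1, h2]
    · intro h
      have h1 : V m ∈ zeroSpan V (f + s • g) := Submodule.subset_span ⟨m, hm0, rfl⟩
      rw [← h] at h1
      exact hm.ne (hgW _ h1)
  have h1 := Submodule.finrank_lt_finrank_of_lt hltW
  have h2 : Module.finrank K (zeroSpan V (f + s • g)) ∈ S :=
    ⟨_, hnn, by rw [hval, hgX]; simpa using hfX, rfl⟩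
  have h3 := le_csSup hbdd h2
  omega

/-- A facet functional is determined, up to a positive factor, by its zeros among the generators. -/
theorem facet_functional_unique {ι : Type*} {V : ι → Fin d → K}
    (hV : ∀ g : Fin d → K, (∀ i, g ⬝ᵥ V i = 0) → g = 0) {f f' : Fin d → K}
    (hf : f ≠ 0)
    (hfV : ∀ i, 0 ≤ f ⬝ᵥ V i) (hfV' : ∀ i, 0 ≤ f' ⬝ᵥ V i)
    (hzero : {i | f ⬝ᵥ V i = 0} = {i | f' ⬝ᵥ V i = 0})
    (hrank : Module.finrank K (zeroSpan V f) + 1 = d) :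
    ∃ c : K, 0 < c ∧ f' = c • f := by
  obtain ⟨k, hk⟩ : ∃ k, f ⬝ᵥ V k ≠ 0 := by
    by_contra! h
    exact hf (hV f h)
  have hk' : f' ⬝ᵥ V k ≠ 0 := fun h => hk (hzero.symm ▸ h : k ∈ {i | f ⬝ᵥ V i = 0})
  refine ⟨f' ⬝ᵥ V k / f ⬝ᵥ V k, div_pos (lt_of_le_of_ne (hfV' k) hk'.symm)
    (lt_of_le_of_ne (hfV k) hk.symm), ?_⟩
  have hlt : zeroSpan V f < zeroSpan V f ⊔ Submodule.span K {V k} := by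
    refine lt_of_le_of_ne le_sup_left fun h => hk (dotProduct_eq_zero_of_mem_zeroSpan (V := V) ?_)
    rw [h]
    exact Submodule.mem_sup_right (Submodule.mem_span_singleton_self _)
  have h1 := Submodule.finrank_lt_finrank_of_lt hlt
  by_contra hne
  -- The difference `f' - c • f` vanishes on the zero span and on `V k`, which together have rank at
  -- least `d`.
  have h2 : Module.finrank K ↥(zeroSpan V f ⊔ Submodule.span K {V k}) < d := by
    refine finrank_lt_of_dotProduct_eq_zero (sub_ne_zero.mpr hne) fun x hx => ?_
    obtain ⟨y, hy, z, hz, rfl⟩ := Submodule.mem_sup.mp hx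
    obtain ⟨a, rfl⟩ := Submodule.mem_span_singleton.mp hz
    have hy1 : f ⬝ᵥ y = 0 := dotProduct_eq_zero_of_mem_zeroSpan hy
    have hy2 : f' ⬝ᵥ y = 0 := dotProduct_eq_zero_of_mem_zeroSpan (V := V)
      (by rwa [zeroSpan, ← hzero])
    simp only [sub_dotProduct, dotProduct_add, smul_dotProduct, dotProduct_smul, hy1, hy2,
      smul_eq_mul]
    field_simp
    ring
  omega

end LinearInequalities

/-! ### Order, leading terms and degrees of Puiseux series -/

namespace PuiseuxField

theorem lt_iff (a b : PuiseuxField) : a < b ↔ ∃ i : ℝᵒᵈ,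
    (∀ j < i, a.toHahn.coeff j = b.toHahn.coeff j) ∧ a.toHahn.coeff i < b.toHahn.coeff i :=
  Iff.rfl

theorem coeff_order_pos {a : PuiseuxField} (ha : 0 < a) : 0 < a.toHahn.coeff a.toHahn.order := by
  rw [← HahnSeries.leadingCoeff_eq]
  exact (pos_iff a).mp ha

/-- The monomial `t ^ x`. -/
noncomputable def monomial (x : ℝ) : PuiseuxField :=
  toLex (HahnSeries.single (OrderDual.toDual x) (1 : ℝ))

theorem monomial_pos (x : ℝ) : 0 < monomial x := by
  rw [pos_iff]
  change 0 < (HahnSeries.single (OrderDual.toDual x) (1 : ℝ)).leadingCoeff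
  simp

end PuiseuxField

namespace Tropical

open PuiseuxField

theorem puiseuxDeg_monomial (x : ℝ) : puiseuxDeg (monomial x) = x := by
  change OrderDual.ofDual (HahnSeries.single (OrderDual.toDual x) (1 : ℝ)).order = x
  rw [HahnSeries.order_single one_ne_zero, OrderDual.ofDual_toDual]

theorem puiseuxDeg_mul {a b : PuiseuxField} (ha : a ≠ 0) (hb : b ≠ 0) :
    puiseuxDeg (a * b) = puiseuxDeg a + puiseuxDeg b := by
  have h : (a.toHahn * b.toHahn).order = a.toHahn.order + b.toHahn.order :=
    HahnSeries.order_mul_of_ne_zero (mul_ne_zero (HahnSeries.leadingCoeff_ne_zero.mpr ha)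
      (HahnSeries.leadingCoeff_ne_zero.mpr hb))
  exact congrArg OrderDual.ofDual h

theorem puiseuxDeg_natCast (n : ℕ) : puiseuxDeg (n : PuiseuxField) = 0 := by
  rcases Nat.eq_zero_or_pos n with rfl | hn
  · rw [Nat.cast_zero]
    exact congrArg OrderDual.ofDual (HahnSeries.order_zero (Γ := ℝᵒᵈ) (R := ℝ))
  · have h : (n : PuiseuxField).toHahn = HahnSeries.single (0 : ℝᵒᵈ) (n : ℝ) :=
      (map_natCast (HahnSeries.C (Γ := ℝᵒᵈ) (R := ℝ)) n).symm
    rw [puiseuxDeg, h, HahnSeries.order_single (Nat.cast_ne_zero.mpr hn.ne')]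
    rfl

theorem puiseuxDeg_natCast_mul {n : ℕ} (hn : n ≠ 0) {a : PuiseuxField} (ha : a ≠ 0) :
    puiseuxDeg (n * a) = puiseuxDeg a := by
  rw [puiseuxDeg_mul (Nat.cast_ne_zero.mpr hn) ha, puiseuxDeg_natCast, zero_add]

theorem puiseuxDeg_neg (a : PuiseuxField) : puiseuxDeg (-a) = puiseuxDeg a :=
  congrArg OrderDual.ofDual (HahnSeries.order_neg (f := a.toHahn))

/-- The leading term of `b` decides the comparison. The proof also covers `a = 0`, whose degree has
the default value 0. -/
theorem lt_of_puiseuxDeg_lt {a b : PuiseuxField} (hb : 0 < b)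
    (h : puiseuxDeg a < puiseuxDeg b) : a < b := by
  have h' : b.toHahn.order < a.toHahn.order := h
  rw [PuiseuxField.lt_iff]
  refine ⟨b.toHahn.order, fun j hj => ?_, ?_⟩
  · rw [HahnSeries.coeff_eq_zero_of_lt_order hj,
      HahnSeries.coeff_eq_zero_of_lt_order (hj.trans h')]
  · rw [HahnSeries.coeff_eq_zero_of_lt_order h']
    exact coeff_order_pos hb

theorem puiseuxDeg_le_of_le {a b : PuiseuxField} (ha : 0 < a) (h : a ≤ b) :
    puiseuxDeg a ≤ puiseuxDeg b := by
  by_contra! hlt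
  exact absurd (lt_of_puiseuxDeg_lt ha hlt) (not_lt.mpr h)

/-- The real coefficients at the leading exponent of `b` are compared by the Archimedean property.
-/
theorem exists_le_natCast_mul {a b : PuiseuxField} (hb : 0 < b)
    (h : puiseuxDeg a ≤ puiseuxDeg b) : ∃ n : ℕ, a ≤ n * b := by
  obtain ⟨n, hn⟩ := exists_nat_gt (a.toHahn.coeff b.toHahn.order / b.toHahn.coeff b.toHahn.order)
  have h' : b.toHahn.order ≤ a.toHahn.order := h
  have hc : ∀ i, ((n : PuiseuxField) * b).toHahn.coeff i = n * b.toHahn.coeff i := fun i => by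
    rw [← nsmul_eq_mul, ← nsmul_eq_mul]
    exact congrFun (HahnSeries.coeff_nsmul (x := b.toHahn) (n := n)) i
  refine ⟨n, le_of_lt ((PuiseuxField.lt_iff _ _).mpr ⟨b.toHahn.order, fun j hj => ?_, ?_⟩)⟩
  · rw [hc, HahnSeries.coeff_eq_zero_of_lt_order hj,
      HahnSeries.coeff_eq_zero_of_lt_order (hj.trans_le h'), mul_zero]
  · rw [hc]
    exact (div_lt_iff₀ (coeff_order_pos hb)).mp hn

/-- A finite sum of series of degree less than that of `a` is less than `a`. -/
theorem sum_lt_of_puiseuxDeg_lt {α : Type*} (s : Finset α) {b : α → PuiseuxField}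
    {a : PuiseuxField} (ha : 0 < a) (h : ∀ j ∈ s, b j ≠ 0 ∧ puiseuxDeg (b j) < puiseuxDeg a) :
    ∑ j ∈ s, b j < a := by
  -- Integer multiples keep the degree, so each term is at most `a / (card + 1)`; the extra 1 makes
  -- the final inequality strict.
  have hn : (0 : PuiseuxField) < (s.card + 1 : ℕ) := by exact_mod_cast Nat.succ_pos _
  have h1 : ∀ j ∈ s, ((s.card + 1 : ℕ) : PuiseuxField) * b j ≤ a := fun j hj =>
    (lt_of_puiseuxDeg_lt ha (by
      rw [puiseuxDeg_natCast_mul (Nat.succ_ne_zero _) (h j hj).1]; exact (h j hj).2)).le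
  have h2 := Finset.sum_le_card_nsmul s _ a h1
  rw [← Finset.mul_sum, nsmul_eq_mul] at h2
  refine lt_of_mul_lt_mul_left (h2.trans_lt ?_) hn.le
  push_cast
  linarith

/-- If a finite sum dominates the positive series `b`, some term has at least the degree of `b`. -/
theorem exists_puiseuxDeg_le_of_le_sum {α : Type*} (s : Finset α) {b : α → PuiseuxField}
    {a : PuiseuxField} (ha : 0 < a) (hb : ∀ j ∈ s, b j ≠ 0) (h : a ≤ ∑ j ∈ s, b j) :
    ∃ j ∈ s, puiseuxDeg a ≤ puiseuxDeg (b j) := by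
  by_contra! hlt
  exact absurd (sum_lt_of_puiseuxDeg_lt s ha fun j hj => ⟨hb j hj, hlt j hj⟩) (not_lt.mpr h)

theorem puiseuxDeg_sum {α : Type*} {s : Finset α} (hs : s.Nonempty) {b : α → PuiseuxField}
    (hb : ∀ j ∈ s, 0 < b j) :
    puiseuxDeg (∑ j ∈ s, b j) = s.sup' hs fun j => puiseuxDeg (b j) := by
  apply le_antisymm
  · obtain ⟨j, hj, hle⟩ := exists_puiseuxDeg_le_of_le_sum s (Finset.sum_pos hb hs)
      (fun j hj => (hb j hj).ne') le_rfl
    exact hle.trans (Finset.le_sup' (fun j => puiseuxDeg (b j)) hj)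
  · exact Finset.sup'_le _ _ fun j hj => puiseuxDeg_le_of_le (hb j hj)
      (Finset.single_le_sum (fun i hi => (hb i hi).le) hj)

end Tropical

/-! ### Images of halfspaces under the degree map -/

namespace Tropical

open PuiseuxField

variable {d : ℕ} {ι : Type*}

theorem ProjSpace.mk_eq_mk_iff {x y : Fin d → ℝ} :
    ProjSpace.mk x = ProjSpace.mk y ↔ ∃ c : ℝ, ∀ j, x j = y j + c := by
  rw [ProjSpace.mk, ProjSpace.mk, Submodule.Quotient.eq, Submodule.mem_span_singleton]
  refine exists_congr fun c => ?_
  rw [funext_iff]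
  refine forall_congr' fun j => ?_
  simp only [Pi.smul_apply, Pi.sub_apply, smul_eq_mul, mul_one]
  constructor <;> intro h <;> linarith

theorem continuous_projSpace_mk : Continuous (ProjSpace.mk : (Fin d → ℝ) → ProjSpace d) :=
  continuous_quot_mk

theorem puiseuxDeg_mul_le_iff {a b c e : PuiseuxField} (ha : a ≠ 0) (hb : b ≠ 0) (hc : c ≠ 0)
    (he : e ≠ 0) : puiseuxDeg (a * b) ≤ puiseuxDeg (c * e) ↔
      puiseuxDeg a + puiseuxDeg b ≤ puiseuxDeg c + puiseuxDeg e := by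
  rw [puiseuxDeg_mul ha hb, puiseuxDeg_mul hc he]

/-- The image of a halfspace consists of the points at which the maximum of the terms
`deg f_j + x_j` is attained at a positive coefficient. -/
theorem mk_mem_halfspaceImage_iff {f : Fin d → PuiseuxField} (hf : f ≠ 0) (x : Fin d → ℝ) :
    ProjSpace.mk x ∈ halfspaceImage f ↔ ∃ i, 0 < f i ∧
      ∀ j, f j ≠ 0 → puiseuxDeg (f j) + x j ≤ puiseuxDeg (f i) + x i := by
  constructor
  · rintro ⟨Y, ⟨hfY, hY⟩, hYx⟩
    obtain ⟨c, hc⟩ := ProjSpace.mk_eq_mk_iff.mp hYx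
    obtain ⟨j₁, hj₁⟩ := Function.ne_iff.mp hf
    obtain ⟨k, hk, hmax⟩ := Finset.exists_max_image (Finset.univ.filter fun j => f j ≠ 0)
      (fun j => puiseuxDeg (f j) + x j) ⟨j₁, by simpa using hj₁⟩
    simp only [Finset.mem_filter, Finset.mem_univ, true_and] at hk hmax
    rcases lt_or_gt_of_ne hk with hneg | hpos
    -- A maximal negative term must be compensated by the positive terms, one of which then has at
    -- least its degree.
    · have hterm : 0 < -f k * Y k := mul_pos (neg_pos.mpr hneg) (hY k)
      have hle : -f k * Y k ≤ ∑ j ∈ Finset.univ.filter (fun j => 0 < f j), f j * Y j := by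
        have h0 : 0 ≤ ∑ j, f j * Y j := hfY
        rw [← Finset.sum_filter_add_sum_filter_not Finset.univ (fun j => 0 < f j)] at h0
        have h1 : -f k * Y k ≤ ∑ j ∈ Finset.univ.filter (fun j => ¬ 0 < f j), -f j * Y j :=
          Finset.single_le_sum (f := fun j => -f j * Y j)
            (fun j hj => mul_nonneg (by simpa using hj) (hY j).le) (by simpa using hneg.le)
        simp only [neg_mul, Finset.sum_neg_distrib] at h1
        linarith
      obtain ⟨i, hi, hdeg⟩ := exists_puiseuxDeg_le_of_le_sum _ hterm
        (fun j hj => mul_ne_zero (by simpa using hj : 0 < f j).ne' (hY j).ne') hle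
      simp only [Finset.mem_filter, Finset.mem_univ, true_and] at hi
      rw [puiseuxDeg_mul_le_iff (neg_ne_zero.mpr hk) (hY k).ne' hi.ne' (hY i).ne',
        puiseuxDeg_neg, hc, hc] at hdeg
      exact ⟨i, hi, fun j hj => (hmax j hj).trans (by linarith)⟩
    · exact ⟨k, hpos, hmax⟩
  · rintro ⟨i, hi, hmax⟩
    have hterm : ∀ j, ∃ n : ℕ, -f j * monomial (x j) ≤ n * (f i * monomial (x i)) := by
      intro j
      rcases eq_or_ne (f j) 0 with hj | hj
      · exact ⟨0, by simp [hj]⟩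
      · refine exists_le_natCast_mul (mul_pos hi (monomial_pos _)) ?_
        rw [puiseuxDeg_mul_le_iff (neg_ne_zero.mpr hj) (monomial_pos _).ne' hi.ne'
          (monomial_pos _).ne', puiseuxDeg_neg, puiseuxDeg_monomial, puiseuxDeg_monomial]
        exact hmax j hj
    choose n hn using hterm
    -- Enlarging coordinate `i` by an integer factor keeps its degree and lets the `i`-th term
    -- absorb all negative ones.
    refine ⟨fun j => ((if j = i then 1 + ∑ j, n j else 1 : ℕ) : PuiseuxField) * monomial (x j),
      ⟨?_, fun j => mul_pos ?_ (monomial_pos _)⟩, ?_⟩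
    · have h1 : ∀ j, f j * (((if j = i then 1 + ∑ j, n j else 1 : ℕ) : PuiseuxField) *
          monomial (x j)) = f j * monomial (x j) +
            if j = i then (∑ j, (n j : PuiseuxField)) * (f i * monomial (x i)) else 0 := by
        intro j
        split_ifs with h
        · subst h; push_cast; ring
        · simp
      have h2 : ∑ j, -f j * monomial (x j) ≤
          (∑ j, (n j : PuiseuxField)) * (f i * monomial (x i)) := by
        rw [Finset.sum_mul]
        exact Finset.sum_le_sum fun j _ => hn j
      change 0 ≤ ∑ j, f j * _
      simp only [h1, Finset.sum_add_distrib, Finset.sum_ite_eq', Finset.mem_univ, if_true]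
      simp only [neg_mul, Finset.sum_neg_distrib] at h2 ⊢
      linarith
    · exact_mod_cast (by split_ifs <;> omega : 0 < if j = i then 1 + ∑ j, n j else 1)
    · refine congrArg ProjSpace.mk (funext fun j => ?_)
      rw [puiseuxDeg_natCast_mul (by split_ifs <;> omega) (monomial_pos _).ne',
        puiseuxDeg_monomial]

theorem isTropicalHalfspace_halfspaceImage {f : Fin d → PuiseuxField} (hpos : ∃ i, 0 < f i)
    (hneg : ∃ i, f i < 0) : IsTropicalHalfspace (halfspaceImage f) := by
  obtain ⟨i₀, hi₀⟩ := hpos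
  obtain ⟨j₀, hj₀⟩ := hneg
  have hf : f ≠ 0 := fun h => by simp [h] at hi₀
  refine ⟨Finset.univ.filter fun j => f j ≠ 0, Finset.univ.filter fun j => 0 < f j,
    fun j => -puiseuxDeg (f j), ⟨i₀, by simpa using hi₀⟩, ?_, ?_⟩
  · rw [Finset.ssubset_iff_of_subset]
    · exact ⟨j₀, by simpa using hj₀.ne, by simpa using hj₀.le⟩
    · intro j hj
      have : 0 < f j := by simpa using hj
      simpa using this.ne'
  · ext p
    have key : ∀ x : Fin d → ℝ, (∃ i, 0 < f i ∧
        ∀ j, f j ≠ 0 → puiseuxDeg (f j) + x j ≤ puiseuxDeg (f i) + x i) ↔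
        ∃ i, 0 < f i ∧ ∀ j, f j ≠ 0 → x j - -puiseuxDeg (f j) ≤ x i - -puiseuxDeg (f i) := by
      intro x
      simp only [sub_neg_eq_add, add_comm (x _)]
    simp only [Set.mem_iUnion, closedSector, Set.mem_ofPred_eq, Finset.mem_filter, Finset.mem_univ,
      true_and, exists_prop]
    constructor
    · obtain ⟨x, rfl⟩ := Submodule.Quotient.mk_surjective _ p
      intro h
      obtain ⟨i, hi, hx⟩ := (key x).mp ((mk_mem_halfspaceImage_iff hf x).mp h)
      exact ⟨i, hi, x, rfl, hx⟩
    · rintro ⟨i, hi, x, rfl, hx⟩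
      exact (mk_mem_halfspaceImage_iff hf x).mpr ((key x).mpr ⟨i, hi, hx⟩)

/-- Every lift of an interior point of the image of a halfspace lies in the open halfspace. -/
theorem dotProduct_pos_of_degMap_mem_interior {f : Fin d → PuiseuxField} (hf : f ≠ 0)
    {X : Fin d → PuiseuxField} (hX : X ∈ posOrthant d)
    (h : degMap X ∈ interior (halfspaceImage f)) : 0 < f ⬝ᵥ X := by
  -- Raising the negative terms slightly stays inside the image, so at `X` itself some positive term
  -- has strictly larger degree than every negative one.
  let path : ℝ → Fin d → ℝ := fun ε j => puiseuxDeg (X j) + if f j < 0 then ε else 0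
  have hpath : Continuous fun ε => ProjSpace.mk (path ε) := by
    refine continuous_projSpace_mk.comp (continuous_pi fun j => ?_)
    by_cases hj : f j < 0 <;> simp only [path, hj, if_true, if_false] <;> fun_prop
  have hopen : IsOpen ((fun ε => ProjSpace.mk (path ε)) ⁻¹' interior (halfspaceImage f)) :=
    isOpen_interior.preimage hpath
  have h0 : (0 : ℝ) ∈ (fun ε => ProjSpace.mk (path ε)) ⁻¹' interior (halfspaceImage f) := by
    simpa [path, degMap] using h
  obtain ⟨δ, hδ, hball⟩ := Metric.isOpen_iff.mp hopen 0 h0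
  have hmem : ProjSpace.mk (path (δ / 2)) ∈ halfspaceImage f := interior_subset
    (hball (by rw [Metric.mem_ball, Real.dist_eq, sub_zero, abs_of_pos] <;> linarith))
  obtain ⟨i, hi, hmax⟩ := (mk_mem_halfspaceImage_iff hf _).mp hmem
  have hsum : ∑ j ∈ Finset.univ.filter (fun j => f j < 0), -f j * X j < f i * X i := by
    refine sum_lt_of_puiseuxDeg_lt _ (mul_pos hi (hX i)) fun j hj => ?_
    have hj : f j < 0 := by simpa using hj
    refine ⟨mul_ne_zero (neg_ne_zero.mpr hj.ne) (hX j).ne', ?_⟩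
    rw [puiseuxDeg_mul (neg_ne_zero.mpr hj.ne) (hX j).ne', puiseuxDeg_mul hi.ne' (hX i).ne',
      puiseuxDeg_neg]
    have h1 := hmax j hj.ne
    simp only [path, hj, if_true, hi.not_gt, if_false] at h1
    linarith
  have hle : f i * X i ≤ ∑ j ∈ Finset.univ.filter (fun j => ¬ f j < 0), f j * X j :=
    Finset.single_le_sum (f := fun j => f j * X j)
      (fun j hj => mul_nonneg (by simpa using hj) (hX j).le) (by simpa using hi.le)
  change 0 < ∑ j, f j * X j
  rw [← Finset.sum_filter_add_sum_filter_not Finset.univ (fun j => f j < 0)]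
  simp only [neg_mul, Finset.sum_neg_distrib] at hsum
  linarith

/-! ### The tropical polytope as image of the cone over its lift -/

section Cone

theorem dotProduct_sum_smul [Fintype ι] (V : ι → Fin d → PuiseuxField) (f : Fin d → PuiseuxField) (u : ι → PuiseuxField) :
    f ⬝ᵥ ∑ i, u i • V i = ∑ i, u i * (f ⬝ᵥ V i) := by
  simp only [dotProduct_sum, dotProduct_smul, smul_eq_mul]

variable [Fintype ι] [Nonempty ι] {v : ι → ProjSpace d} {V : ι → Fin d → PuiseuxField}

theorem sum_smul_mem_posOrthant (hV : ∀ i, V i ∈ posOrthant d) {u : ι → PuiseuxField}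
    (hu : ∀ i, 0 < u i) : ∑ i, u i • V i ∈ posOrthant d := by
  intro j
  rw [Finset.sum_apply]
  exact Finset.sum_pos (fun i _ => mul_pos (hu i) (hV i j)) Finset.univ_nonempty

theorem degMap_sum_smul (hV : ∀ i, V i ∈ posOrthant d) {u : ι → PuiseuxField}
    (hu : ∀ i, 0 < u i) : degMap (∑ i, u i • V i) = ProjSpace.mk fun j =>
      Finset.univ.sup' Finset.univ_nonempty fun i => puiseuxDeg (V i j) + puiseuxDeg (u i) := by
  refine congrArg ProjSpace.mk (funext fun j => ?_)
  rw [Finset.sum_apply, puiseuxDeg_sum (b := fun i => (u i • V i) j) Finset.univ_nonempty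
    fun i _ => mul_pos (hu i) (hV i j)]
  congr 1
  funext i
  rw [Pi.smul_apply, smul_eq_mul, puiseuxDeg_mul (hu i).ne' (hV i j).ne', add_comm]

/-- A tropical polytope is the image under the degree map of the open cone over any lift. -/
theorem mem_tconv_iff (hV : IsLift v V) (p : ProjSpace d) :
    p ∈ tconv v ↔ ∃ u : ι → PuiseuxField, (∀ i, 0 < u i) ∧ degMap (∑ i, u i • V i) = p := by
  constructor
  · rintro ⟨w, hw, rfl⟩
    have : ∀ i, ∃ c : ℝ, ∀ j, w i j = puiseuxDeg (V i j) + c := fun i =>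
      ProjSpace.mk_eq_mk_iff.mp ((hw i).trans (hV i).2.symm)
    choose c hc using this
    refine ⟨fun i => monomial (c i), fun i => monomial_pos _, ?_⟩
    rw [degMap_sum_smul (fun i => (hV i).1) fun i => monomial_pos _]
    simp only [puiseuxDeg_monomial, hc]
  · rintro ⟨u, hu, rfl⟩
    refine ⟨fun i j => puiseuxDeg (V i j) + puiseuxDeg (u i), fun i => ?_,
      degMap_sum_smul (fun i => (hV i).1) hu⟩
    rw [← (hV i).2]
    exact ProjSpace.mk_eq_mk_iff.mpr ⟨_, fun j => rfl⟩

/-- Farkas' lemma gives weights that may vanish, while `mem_tconv_iff` needs positive ones. Adding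
to all weights a monomial of sufficiently low degree repairs this without changing any coordinate's
degree. -/
theorem degMap_sum_smul_mem_tconv (hV : IsLift v V) {u : ι → PuiseuxField} (hu : ∀ i, 0 ≤ u i)
    (hX : ∑ i, u i • V i ∈ posOrthant d) : degMap (∑ i, u i • V i) ∈ tconv v := by
  set X := ∑ i, u i • V i with hXdef
  have hS : ∑ i, V i ∈ posOrthant d := by
    simpa using sum_smul_mem_posOrthant (fun i => (hV i).1) (u := fun _ => 1) fun _ => one_pos
  set S := ∑ i, V i with hSdef
  obtain ⟨M, hM⟩ := Finset.exists_le (Finset.univ.image fun j => puiseuxDeg (S j) -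
    puiseuxDeg (X j))
  have hM : ∀ j, puiseuxDeg (S j) - puiseuxDeg (X j) ≤ M := fun j =>
    hM _ (Finset.mem_image_of_mem _ (Finset.mem_univ j))
  refine (mem_tconv_iff hV _).mpr ⟨fun i => u i + monomial (-(M + 1)),
    fun i => add_pos_of_nonneg_of_pos (hu i) (monomial_pos _), ?_⟩
  have hsum : ∑ i, (u i + monomial (-(M + 1))) • V i = X + monomial (-(M + 1)) • S := by
    simp only [add_smul, Finset.sum_add_distrib, ← Finset.smul_sum, hXdef, hSdef]
  rw [hsum]
  refine congrArg ProjSpace.mk (funext fun j => ?_)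
  have hpos : 0 < monomial (-(M + 1)) * S j := mul_pos (monomial_pos _) (hS j)
  change puiseuxDeg (X j + monomial (-(M + 1)) * S j) = _
  apply le_antisymm
  · have hlt : monomial (-(M + 1)) * S j < X j := by
      refine lt_of_puiseuxDeg_lt (hX j) ?_
      rw [puiseuxDeg_mul (monomial_pos _).ne' (hS j).ne', puiseuxDeg_monomial]
      linarith [hM j]
    rw [← puiseuxDeg_natCast_mul two_ne_zero (hX j).ne']
    refine puiseuxDeg_le_of_le (add_pos (hX j) hpos) ?_
    push_cast
    linarith
  · exact puiseuxDeg_le_of_le (hX j) (by linarith)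

theorem tconv_subset_halfspaceImage (hV : IsLift v V) {f : Fin d → PuiseuxField}
    (hf : ∀ i, 0 ≤ f ⬝ᵥ V i) : tconv v ⊆ halfspaceImage f := by
  intro p hp
  obtain ⟨u, hu, rfl⟩ := (mem_tconv_iff hV p).mp hp
  refine ⟨_, ⟨?_, sum_smul_mem_posOrthant (fun i => (hV i).1) hu⟩, rfl⟩
  change 0 ≤ f ⬝ᵥ _
  rw [dotProduct_sum_smul]
  exact Finset.sum_nonneg fun i _ => mul_nonneg (hu i).le (hf i)

/-- The lift of a full-dimensional tropical polytope spans the whole space. -/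
theorem eq_zero_of_dotProduct_eq_zero (hV : IsLift v V) (hfull : (interior (tconv v)).Nonempty)
    {g : Fin d → PuiseuxField} (hg : ∀ i, g ⬝ᵥ V i = 0) : g = 0 := by
  by_contra hne
  obtain ⟨p, hp⟩ := hfull
  obtain ⟨u, hu, rfl⟩ := (mem_tconv_iff hV p).mp (interior_subset hp)
  -- Since `g` is nonnegative on the generators, it would be strictly positive on a lift of an
  -- interior point, yet it vanishes on the cone.
  have h := dotProduct_pos_of_degMap_mem_interior hne
    (sum_smul_mem_posOrthant (fun i => (hV i).1) hu)
    (interior_mono (tconv_subset_halfspaceImage hV fun i => (hg i).ge) hp)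
  rw [dotProduct_sum_smul] at h
  simp [hg] at h

end Cone

/-! ### Facets of the lifted polytope -/

section Facet

variable [Fintype ι] {V : ι → Fin d → PuiseuxField}

theorem mem_liftedPolytope_iff (X : Fin d → PuiseuxField) : X ∈ liftedPolytope V ↔
    ∃ w : ι → PuiseuxField, (∀ i, 0 ≤ w i) ∧ ∑ i, w i = 1 ∧ ∑ i, w i • V i = X := by
  have h : liftedPolytope V =
      Fintype.linearCombination PuiseuxField V '' stdSimplex PuiseuxField ι := by
    classical
    rw [liftedPolytope, ← convexHull_basis_eq_stdSimplex, LinearMap.image_convexHull,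
      ← Set.range_comp]
    congr 2
    funext i
    simp [Fintype.linearCombination_apply]
  rw [h]
  simp only [Set.mem_image, stdSimplex, Set.mem_ofPred_eq, and_assoc,
    Fintype.linearCombination_apply]

/-- A convex combination lies on a supporting hyperplane only if every generator of nonzero weight
does, so the face and its span can be read off the generators. -/
theorem isFacetDefining_iff (f : Fin d → PuiseuxField) :
    IsFacetDefining (liftedPolytope V) f ↔ f ≠ 0 ∧ (∀ i, 0 ≤ f ⬝ᵥ V i) ∧
      (∃ i, f ⬝ᵥ V i = 0) ∧ Module.finrank PuiseuxField (zeroSpan V f) + 1 = d := by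
  have hmem : ∀ i, V i ∈ liftedPolytope V := fun i => subset_convexHull _ _ ⟨i, rfl⟩
  have hnn : liftedPolytope V ⊆ halfspace f ↔ ∀ i, 0 ≤ f ⬝ᵥ V i := by
    refine ⟨fun h i => h (hmem i), fun h X hX => ?_⟩
    obtain ⟨w, hw, -, rfl⟩ := (mem_liftedPolytope_iff X).mp hX
    change 0 ≤ f ⬝ᵥ _
    rw [dotProduct_sum_smul]
    exact Finset.sum_nonneg fun i _ => mul_nonneg (hw i) (h i)
  have hzero : (∀ i, 0 ≤ f ⬝ᵥ V i) → ∀ w : ι → PuiseuxField, (∀ i, 0 ≤ w i) →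
      ∑ i, w i • V i ∈ hyperplane f → ∀ i, w i = 0 ∨ f ⬝ᵥ V i = 0 := by
    intro h w hw hX i
    have hX : f ⬝ᵥ ∑ i, w i • V i = 0 := hX
    rw [dotProduct_sum_smul,
      Finset.sum_eq_zero_iff_of_nonneg fun i _ => mul_nonneg (hw i) (h i)] at hX
    exact mul_eq_zero.mp (hX i (Finset.mem_univ i))
  have hspan : (∀ i, 0 ≤ f ⬝ᵥ V i) →
      Submodule.span PuiseuxField (liftedPolytope V ∩ hyperplane f) = zeroSpan V f := by
    intro h
    apply le_antisymm
    · refine Submodule.span_le.mpr ?_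
      rintro X ⟨hX, hXf⟩
      obtain ⟨w, hw, -, rfl⟩ := (mem_liftedPolytope_iff X).mp hX
      refine Submodule.sum_mem _ fun i _ => ?_
      rcases hzero h w hw hXf i with hi | hi
      · rw [hi, zero_smul]
        exact Submodule.zero_mem _
      · exact Submodule.smul_mem _ _ (Submodule.subset_span ⟨i, hi, rfl⟩)
    · refine Submodule.span_mono ?_
      rintro _ ⟨i, hi, rfl⟩
      exact ⟨hmem i, hi⟩
  have hne : (∀ i, 0 ≤ f ⬝ᵥ V i) →
      ((liftedPolytope V ∩ hyperplane f).Nonempty ↔ ∃ i, f ⬝ᵥ V i = 0) := by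
    intro h
    constructor
    · rintro ⟨X, hX, hXf⟩
      obtain ⟨w, hw, hw1, rfl⟩ := (mem_liftedPolytope_iff X).mp hX
      by_contra! hcon
      have : ∀ i, w i = 0 := fun i => (hzero h w hw hXf i).resolve_right (hcon i)
      simp [this] at hw1
    · rintro ⟨i, hi⟩
      exact ⟨V i, hmem i, hi⟩
  rw [IsFacetDefining, hnn]
  refine and_congr_right fun _ => and_congr_right fun h => ?_
  rw [hne h, hspan h]

theorem exists_pos_and_exists_neg_of_isFacetDefining (hV : ∀ i, V i ∈ posOrthant d)
    {f : Fin d → PuiseuxField} (hf : IsFacetDefining (liftedPolytope V) f) :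
    (∃ i, 0 < f i) ∧ ∃ i, f i < 0 := by
  obtain ⟨hf0, -, ⟨i, hi⟩, -⟩ := (isFacetDefining_iff f).mp hf
  have hi : ∑ j, f j * V i j = 0 := hi
  constructor <;> by_contra! hcon
  · rw [Finset.sum_eq_zero_iff_of_nonpos fun j _ =>
      mul_nonpos_of_nonpos_of_nonneg (hcon j) (hV i j).le] at hi
    exact hf0 (funext fun j => (mul_eq_zero.mp (hi j (Finset.mem_univ j))).resolve_right
      (hV i j).ne')
  · rw [Finset.sum_eq_zero_iff_of_nonneg fun j _ => mul_nonneg (hcon j) (hV i j).le] at hi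
    exact hf0 (funext fun j => (mul_eq_zero.mp (hi j (Finset.mem_univ j))).resolve_right
      (hV i j).ne')

/-- A positive point outside the cone over the lifted polytope is cut off by a facet. -/
theorem exists_isFacetDefining_dotProduct_neg (hV : ∀ i, V i ∈ posOrthant d)
    [Nonempty ι] (hspan : ∀ g : Fin d → PuiseuxField, (∀ i, g ⬝ᵥ V i = 0) → g = 0)
    {X f₀ : Fin d → PuiseuxField} (hX : X ∈ posOrthant d) (hf₀ : ∀ i, 0 ≤ f₀ ⬝ᵥ V i)
    (hf₀X : f₀ ⬝ᵥ X < 0) :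
    ∃ f, IsFacetDefining (liftedPolytope V) f ∧ f ⬝ᵥ X < 0 := by
  obtain ⟨f, hfV, hfX, hrank⟩ := exists_facet_functional hspan hf₀ hf₀X
  refine ⟨f, (isFacetDefining_iff f).mpr ⟨?_, hfV, ?_, hrank⟩, hfX⟩
  · rintro rfl
    simp at hfX
  · by_contra! hcon
    -- With no generator on the hyperplane the rank condition forces `d = 1`, where `f` has the same
    -- sign at all positive points.
    have hbot : zeroSpan V f = ⊥ := by
      rw [zeroSpan, Set.eq_empty_of_forall_notMem (s := {i | f ⬝ᵥ V i = 0}) hcon,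
        Set.image_empty, Submodule.span_empty]
    rw [hbot, finrank_bot] at hrank
    subst hrank
    obtain ⟨i⟩ := ‹Nonempty ι›
    have h1 : 0 ≤ f 0 * V i 0 := by simpa [dotProduct] using hfV i
    have h2 : f 0 * X 0 < 0 := by simpa [dotProduct] using hfX
    exact absurd (nonneg_of_mul_nonneg_left h1 (hV i 0))
      (not_le.mpr (neg_of_mul_neg_left h2 (hX 0).le))

end Facet

end Tropical

/-! ### The main theorem -/

open Tropical in
theorem mainTheorem6 {d : ℕ} {ι : Type*} [Fintype ι] [Nonempty ι]
    (v : ι → Tropical.ProjSpace d)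
    (hfull : (interior (Tropical.tconv v)).Nonempty)
    (V : ι → Fin d → PuiseuxField) (hV : Tropical.IsLift v V) :
    (∀ f : Fin d → PuiseuxField,
        Tropical.IsFacetDefining (Tropical.liftedPolytope V) f →
          Tropical.IsTropicalHalfspace (Tropical.halfspaceImage f)) ∧
      (⋂ (f : Fin d → PuiseuxField)
          (_ : Tropical.IsFacetDefining (Tropical.liftedPolytope V) f),
          interior (Tropical.halfspaceImage f)) =
        interior (Tropical.tconv v) := by
  have hpos : ∀ i, V i ∈ posOrthant d := fun i => (hV i).1
  have hspan : ∀ g : Fin d → PuiseuxField, (∀ i, g ⬝ᵥ V i = 0) → g = 0 :=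
    fun g => eq_zero_of_dotProduct_eq_zero hV hfull
  refine ⟨fun f hf => ?_, Set.Subset.antisymm ?_ ?_⟩
  · obtain ⟨h1, h2⟩ := exists_pos_and_exists_neg_of_isFacetDefining hpos hf
    exact isTropicalHalfspace_halfspaceImage h1 h2
  · -- One facet for each possible zero set suffices, so the intersection contains a finite one.
    have hrep : ∀ s : Set ι, ∃ U : Set (ProjSpace d), IsOpen U ∧
        (⋂ (f : Fin d → PuiseuxField) (_ : IsFacetDefining (liftedPolytope V) f),
          interior (halfspaceImage f)) ⊆ U ∧
        ∀ f, IsFacetDefining (liftedPolytope V) f → {i | f ⬝ᵥ V i = 0} = s →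
          ∀ X ∈ posOrthant d, degMap X ∈ U → 0 < f ⬝ᵥ X := by
      intro s
      by_cases hs : ∃ f, IsFacetDefining (liftedPolytope V) f ∧ {i | f ⬝ᵥ V i = 0} = s
      · obtain ⟨f, hf, hfs⟩ := hs
        refine ⟨interior (halfspaceImage f), isOpen_interior, Set.iInter₂_subset f hf, ?_⟩
        intro f' hf' hfs' X hX hXU
        obtain ⟨hf0, hfV, -, hrank⟩ := (isFacetDefining_iff f).mp hf
        have hfV' := ((isFacetDefining_iff f').mp hf').2.1
        obtain ⟨c, hc, rfl⟩ := facet_functional_unique hspan hf0 hfV hfV'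
          (hfs.trans hfs'.symm) hrank
        rw [smul_dotProduct]
        exact mul_pos hc (dotProduct_pos_of_degMap_mem_interior hf0 hX hXU)
      · exact ⟨Set.univ, isOpen_univ, Set.subset_univ _, fun f hf hfs => absurd ⟨f, hf, hfs⟩ hs⟩
    choose U hUo hUsub hUpos using hrep
    have hsub : (⋂ s, U s) ⊆ tconv v := by
      intro p hp
      obtain ⟨x, rfl⟩ := Submodule.Quotient.mk_surjective _ p
      have hX : (fun j => PuiseuxField.monomial (x j)) ∈ posOrthant d :=
        fun j => PuiseuxField.monomial_pos _
      have hdeg : degMap (fun j => PuiseuxField.monomial (x j)) = ProjSpace.mk x :=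
        congrArg ProjSpace.mk (funext fun j => puiseuxDeg_monomial _)
      change ProjSpace.mk x ∈ _ at hp
      change ProjSpace.mk x ∈ _
      rw [← hdeg] at hp ⊢
      -- If the monomial lift were outside the cone, some facet would cut it off, contradicting
      -- positivity on the open set attached to the zero set of that facet.
      obtain ⟨u, hu, hXu⟩ := exists_nonneg_sum_smul_eq V _ fun f₀ hf₀ => by
        by_contra! hneg
        obtain ⟨f, hf, hfX⟩ := exists_isFacetDefining_dotProduct_neg hpos hspan hX hf₀ hneg
        exact absurd (hUpos _ f hf rfl _ hX (Set.mem_iInter.mp hp _)) hfX.not_gt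
      rw [hXu] at hX ⊢
      exact degMap_sum_smul_mem_tconv hV hu hX
    -- There are finitely many subsets of `ι`, so the intersection of the `U s` is open and lies in
    -- the interior.
    exact (Set.subset_iInter hUsub).trans
      (interior_maximal hsub (isOpen_iInter_of_finite hUo))
  · refine Set.subset_iInter₂ fun f hf => interior_mono (tconv_subset_halfspaceImage hV ?_)
    exact ((isFacetDefining_iff f).mp hf).2.1
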